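/- Let $n_u,n_x,n_y\ge 0$. A linear system is a tuple $S=(A,B,C,D)$ of real matrices of sizes $n_x\times n_x$, $n_x\times n_u$, $n_y\times n_x$, $n_y\times n_u$, with dynamics $x_{k+1}=Ax_k+Bu_k$, $y_k=Cx_k+Du_k$. Two systems with the same numbers of inputs and outputs are equivalent if, from zero initial states, they produce identical outputs for all input sequences; $S$ is minimal if no equivalent system has fewer state variables. The graph $G(S)$ is the directed graph with vertices $x_1,\dots,x_{n_x}$ (states), $u_1,\dots,u_{n_u}$ (inputs), $y_1,\dots,y_{n_y}$ (outputs) and edges $x_j\to x_i$ iff $A_{ij}\ne0$, $u_j\to x_i$ iff $B_{ij}\neq0$, $x_j\to y_i$ iff $C_{ij}\ne0$, $u_j\to y_i$ iff $D_{ij}\ne0$, and no others. A structured linear system $\mathbf S$ is given by prescribing a set of entries of $A,B,C,D$ to be zero (the fixed zeros), all the remaining entries being independent free real parameters; for a parameter vector $p\in\mathbb R^k$ ($k$ being the number of free entries) let $\mathbf S_p$ be the resulting system. $\mathbf S$ is generically minimal if there is a polynomial $f$ in $k$ variables with real coefficients, not vanishing identically on $\mathbb R^k$, such that $\mathbf S_p$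 is minimal for every $p$ with $f(p)\neq0$. The graph $G(\mathbf S)$ is the graph of $\mathbf S_p$ with all parameters equal to $1$. A path is a nonempty sequence of vertices $v_1v_2\cdots v_k$, each consecutive pair being an edge $v_i\to v_{i+1}$, in which no two vertices are equal except possibly $v_1$ and $v_k$. It is a cycle if $k\ge2$ and $v_1=v_k$ (a loop at $v$ gives the cycle $vv$), and a simple path otherwise. It is $U$-rooted if $v_1$ is an input vertex and $Y$-topped if $v_k$ is an output vertex. Two paths are disjoint if they have no common vertex. A path family (cycle family) is a set of pairwise disjoint simple paths (cycles); a path family is $U$-rooted ($Y$-topped) if all its members are. The union of two families is disjoint if each member of the first is disjoint from each member of the second, and it covers the vertices that occur in its members. Theorem. A structured linear system $\mathbf S$ is generically minimal if and only if its graph $G(\mathbf S)$ satisfies the following four conditions: 1. every state vertex $x_i$ is the end vertex of a $U$-rooted path in $G(\mathbf S)$; 2. there is a disjoint union of a $U$-rooted path family and a cycle family in $G(\mathbf S)$ that covers all the state vertices; 3. every state vertex $x_i$ is the first vertex of a $Y$-topped path in $G(\mathbf S)$; 4. there is a disjoint union of a $Y$-topped path family and a cycle family in $G(\mathbf S)$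 that covers all the state vertices. -/

import Mathlib

open scoped Matrix

/-- A discrete-time LTI state-space system `x_{k+1} = A x_k + B u_k`, `y_k = C x_k + D u_k`
with `nu` inputs, `nx` state variables and `ny` outputs. -/
structure LTISystem (nu nx ny : ℕ) where
  A : Matrix (Fin nx) (Fin nx) ℝ
  B : Matrix (Fin nx) (Fin nu) ℝ
  C : Matrix (Fin ny) (Fin nx) ℝ
  D : Matrix (Fin ny) (Fin nu) ℝ

namespace LTISystem

variable {nu nx ny : ℕ}

/-- The state sequence driven by the input sequence `u`, started at the zero state. -/
def state (S : LTISystem nu nx ny) (u : ℕ → Fin nu → ℝ) : ℕ → Fin nx → ℝ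
  | 0 => 0
  | k + 1 => S.A *ᵥ S.state u k + S.B *ᵥ u k

/-- The output sequence for the input sequence `u` and zero initial state. -/
def output (S : LTISystem nu nx ny) (u : ℕ → Fin nu → ℝ) (k : ℕ) : Fin ny → ℝ :=
  S.C *ᵥ S.state u k + S.D *ᵥ u k

/-- Two systems with the same inputs and outputs, but possibly different numbers of state
variables, are equivalent if from zero initial states they produce the same outputs for all
input sequences. -/
def Equivalent {nx' : ℕ} (S : LTISystem nu nx ny) (S' : LTISystem nu nx' ny) : Prop :=
  ∀ (u : ℕ → Fin nu → ℝ) (k : ℕ), S.output u k = S'.output u k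

/-- A system is minimal if no equivalent system has fewer state variables. -/
def IsMinimal (S : LTISystem nu nx ny) : Prop :=
  ∀ (nx' : ℕ) (S' : LTISystem nu nx' ny), S.Equivalent S' → nx ≤ nx'

end LTISystem

/-- The vertices of the graph of a system: states, then inputs, then outputs. -/
abbrev SysVertex (nu nx ny : ℕ) : Type := (Fin nx ⊕ Fin nu) ⊕ Fin ny

namespace SysVertex

variable {nu nx ny : ℕ}

/-- The state vertex `x_i`. -/
def x (i : Fin nx) : SysVertex nu nx ny := Sum.inl (Sum.inl i)

/-- The input vertex `u_i`. -/
def u (i : Fin nu) : SysVertex nu nx ny := Sum.inl (Sum.inr i)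

/-- The output vertex `y_i`. -/
def y (i : Fin ny) : SysVertex nu nx ny := Sum.inr i

end SysVertex

/-- The associated graph of a square matrix: there is an edge from `v` to `w` if and only if
the entry in row `w` and column `v` is nonzero. -/
def matrixGraph {V : Type*} (M : Matrix V V ℝ) : Digraph V where
  Adj v w := M w v ≠ 0

/-- The associated graph of a system is that of the block matrix
`[A B 0; 0 0 0; C D 0]`. -/
def LTISystem.graph {nu nx ny : ℕ} (S : LTISystem nu nx ny) : Digraph (SysVertex nu nx ny) :=
  matrixGraph (Matrix.fromBlocks
    (Matrix.fromBlocks S.A S.B 0 0) 0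
    (Matrix.fromCols S.C S.D) 0)

/-- A structured linear system, given by the positions of the fixed zeros of its four structured
matrices; all other entries are free. -/
structure StructuredSystem (nu nx ny : ℕ) where
  TA : Set (Fin nx × Fin nx)
  TB : Set (Fin nx × Fin nu)
  TC : Set (Fin ny × Fin nx)
  TD : Set (Fin ny × Fin nu)

/-- The standard parameterization of the structured matrix with fixed zeros `T`; the
coordinates of a parameter vector are indexed by the free positions. -/
noncomputable def structuredMatrix {m n : ℕ} (T : Set (Fin m × Fin n))
    (v : ↥(Tᶜ) → ℝ) : Matrix (Fin m) (Fin n) ℝ :=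
  open Classical in
  Matrix.of fun i j => if h : (i, j) ∈ T then 0 else v ⟨(i, j), h⟩

namespace StructuredSystem

variable {nu nx ny : ℕ}

/-- The index set of the parameters: one parameter for each free entry of each matrix. -/
abbrev Param (S : StructuredSystem nu nx ny) : Type :=
  (↥(S.TAᶜ) ⊕ ↥(S.TBᶜ)) ⊕ (↥(S.TCᶜ) ⊕ ↥(S.TDᶜ))

/-- The standard parameterization `p ↦ S_p` of a structured system. -/
noncomputable def sys (S : StructuredSystem nu nx ny) (p : S.Param → ℝ) : LTISystem nu nx ny where
  A := structuredMatrix S.TA fun t => p (Sum.inl (Sum.inl t))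
  B := structuredMatrix S.TB fun t => p (Sum.inl (Sum.inr t))
  C := structuredMatrix S.TC fun t => p (Sum.inr (Sum.inl t))
  D := structuredMatrix S.TD fun t => p (Sum.inr (Sum.inr t))

/-- A property of systems is generic for `S` if it holds for `S_p` for all parameter vectors `p`
outside of some proper variety `{p | f p = 0} ≠ ℝ^k`. -/
def IsGeneric (S : StructuredSystem nu nx ny) (P : LTISystem nu nx ny → Prop) : Prop :=
  ∃ f : MvPolynomial S.Param ℝ,
    {p : S.Param → ℝ | MvPolynomial.eval p f = 0} ≠ Set.univ ∧
    ∀ p : S.Param → ℝ, p ∉ {p : S.Param → ℝ | MvPolynomial.eval p f = 0} → P (S.sys p)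

/-- The graph of a structured system is the graph of the member whose parameters are all `1`. -/
noncomputable def graph (S : StructuredSystem nu nx ny) : Digraph (SysVertex nu nx ny) :=
  (S.sys fun _ => 1).graph

end StructuredSystem

section Paths

variable {V : Type*}

/-- A path is a nonempty sequence of vertices along edges of `G` in which no two vertices are
equal, except possibly the first and the last. -/
def Digraph.IsPathList (G : Digraph V) (l : List V) : Prop :=
  l ≠ [] ∧ l.IsChain G.Adj ∧
    ∀ (i j : ℕ) (hij : i < j) (hj : j < l.length),
      l[i]'(hij.trans hj) = l[j] → i = 0 ∧ j + 1 = l.length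

/-- A cycle is a path with at least one edge whose first and last vertices are equal. A loop at
`v` is the cycle `[v, v]`; the sequence `[v]` is not a cycle. -/
def Digraph.IsCycleList (G : Digraph V) (l : List V) : Prop :=
  G.IsPathList l ∧ 2 ≤ l.length ∧ l.head? = l.getLast?

/-- A simple path is a path that is not a cycle. -/
def Digraph.IsSimplePathList (G : Digraph V) (l : List V) : Prop :=
  G.IsPathList l ∧ ¬ G.IsCycleList l

/-- A path family is a set of pairwise disjoint simple paths. -/
def Digraph.IsPathFamily (G : Digraph V) (F : Set (List V)) : Prop :=
  (∀ l ∈ F, G.IsSimplePathList l) ∧ F.Pairwise List.Disjoint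

/-- A cycle family is a set of pairwise disjoint cycles. -/
def Digraph.IsCycleFamily (G : Digraph V) (F : Set (List V)) : Prop :=
  (∀ l ∈ F, G.IsCycleList l) ∧ F.Pairwise List.Disjoint

/-- The union of the families `F₁` and `F₂` is disjoint. -/
def FamiliesDisjoint (F₁ F₂ : Set (List V)) : Prop :=
  ∀ l₁ ∈ F₁, ∀ l₂ ∈ F₂, List.Disjoint l₁ l₂

/-- Some member of the family `F` covers the vertex `v`. -/
def FamilyCovers (F : Set (List V)) (v : V) : Prop :=
  ∃ l ∈ F, v ∈ l

end Paths

/-- The sequence starts at an input vertex. -/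
def URooted {nu nx ny : ℕ} (l : List (SysVertex nu nx ny)) : Prop :=
  ∃ i : Fin nu, l.head? = some (SysVertex.u i)

/-- The sequence ends at an output vertex. -/
def YTopped {nu nx ny : ℕ} (l : List (SysVertex nu nx ny)) : Prop :=
  ∃ j : Fin ny, l.getLast? = some (SysVertex.y j)

/-!
A system is minimal if and only if it is controllable and observable
(`LTISystem.isMinimal_of_controllable`, `LTISystem.IsMinimal.controllable`), and observability is
controllability of the dual system, whose graph is obtained by reversing all edges and exchanging
inputs with outputs. Controllability holds as soon as some minor of the controllability matrix,
a polynomial in the parameters, is nonzero (`Controllable.exists_polynomial`). Hence it suffices to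
show that a structured pair `[A B]` has a controllable member if and only if its graph satisfies the
two conditions on the input side.

The covering of the states by disjoint paths and cycles amounts to an injective map `σ` that chooses
a predecessor, a state or an input, for each state
(`StructuredSystem.exists_injective_of_families`, `StructuredSystem.exists_families_of_injective`).
If some member is controllable, unreachable states cannot exist, and `σ` is read off from a nonzero
term of a maximal minor of `[A B]`.

Conversely, the edges of `σ` form stems, which start at inputs, and cycles. The stems alone are a
controllable subsystem. As all states are reachable, there is then an edge from an input or from the
subsystem to some vertex of a remaining cycle. Adding this edge and the cycle, with a large weight
`t` on its edges, preserves controllability (`HautusOn.exists_larger`): by the eigenvector test, an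
uncontrollable mode would have to be an eigenvalue of absolute value `t` that is cancelled by the
old subsystem, but such eigenvalues are bounded (`exists_bound_resonance`). After finitely many
steps all states are included.
-/

/-! ### Controllability and minimality -/

/-- If no nonzero vector is orthogonal to the whole family `v`, then some `n` members of the family
form an invertible matrix. -/
theorem exists_selection_det_ne_zero {n : ℕ} {ι : Type*} (v : ι → Fin n → ℝ)
    (h : ∀ z : Fin n → ℝ, (∀ a, z ⬝ᵥ v a = 0) → z = 0) :
    ∃ g : Fin n → ι, (Matrix.of fun i r => v (g r) i).det ≠ 0 := by
  have hspan : Submodule.span ℝ (Set.range v) = ⊤ := by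
    by_contra hne
    obtain ⟨f, hf, hle⟩ := Submodule.exists_le_ker_of_lt_top _ (lt_top_iff_ne_top.2 hne)
    have hdot : ∀ w, (fun i => f (Pi.single i 1)) ⬝ᵥ w = f w := fun w => by
      conv_rhs => rw [pi_eq_sum_univ' w, map_sum]
      simp [dotProduct, mul_comm]
    have h0 := h (fun i => f (Pi.single i 1)) fun a => by
      rw [hdot]
      exact hle (Submodule.subset_span ⟨a, rfl⟩)
    refine hf (LinearMap.ext fun w => ?_)
    rw [← hdot, h0]
    simp
  obtain ⟨κ, a, -, hsp, hli⟩ := exists_linearIndependent' ℝ v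
  let b := Module.Basis.mk hli (by rw [hsp, hspan])
  let e := (Pi.basisFun ℝ (Fin n)).indexEquiv b
  refine ⟨a ∘ e, ?_⟩
  have hli' : LinearIndependent ℝ (Matrix.of fun r i => v (a (e r)) i).row :=
    hli.comp e e.injective
  rw [Matrix.linearIndependent_rows_iff_isUnit, Matrix.isUnit_iff_isUnit_det] at hli'
  rw [← Matrix.det_transpose]
  exact hli'.ne_zero

/-- The pair `(A, B)` is controllable: no nonzero row vector `z` satisfies `z A^k B = 0` for all
`k`, that is, the columns of the matrices `A^k B` span the state space. Applied to `(Aᵀ, Cᵀ)`, this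
is observability of `(A, C)`. -/
def Controllable {n m : ℕ} (A : Matrix (Fin n) (Fin n) ℝ) (B : Matrix (Fin n) (Fin m) ℝ) : Prop :=
  ∀ z : Fin n → ℝ, (∀ k : ℕ, z ᵥ* (A ^ k * B) = 0) → z = 0

/-- The matrix whose column `r` is the column `a` of `A ^ k * B`, where `(k, a) = g r`. The ring is
arbitrary so that the entries can be polynomials in the parameters. -/
def kalmanSubmatrix {R : Type*} [CommRing R] {n m d : ℕ} (A : Matrix (Fin n) (Fin n) R)
    (B : Matrix (Fin n) (Fin m) R) (g : Fin d → ℕ × Fin m) : Matrix (Fin n) (Fin d) R :=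
  Matrix.of fun i r => (A ^ (g r).1 * B) i (g r).2

theorem controllable_iff_exists_det_ne_zero {n m : ℕ} {A : Matrix (Fin n) (Fin n) ℝ}
    {B : Matrix (Fin n) (Fin m) ℝ} :
    Controllable A B ↔ ∃ g : Fin n → ℕ × Fin m, (kalmanSubmatrix A B g).det ≠ 0 := by
  constructor
  · intro h
    exact exists_selection_det_ne_zero (fun (a : ℕ × Fin m) i => (A ^ a.1 * B) i a.2) fun z hz =>
      h z fun k => funext fun j => hz (k, j)
  · rintro ⟨g, hg⟩ z hz
    refine Matrix.eq_zero_of_vecMul_eq_zero hg (funext fun r => ?_)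
    exact congrFun (hz (g r).1) (g r).2

/-- Controllability is an open condition in the Zariski topology: if it holds at one parameter
vector, then it holds wherever a certain minor of the controllability matrix is nonzero. -/
theorem Controllable.exists_polynomial {ι : Type*} {n m : ℕ}
    (A : Matrix (Fin n) (Fin n) (MvPolynomial ι ℝ)) (B : Matrix (Fin n) (Fin m) (MvPolynomial ι ℝ))
    {p₀ : ι → ℝ}
    (h : Controllable (A.map (MvPolynomial.eval p₀)) (B.map (MvPolynomial.eval p₀))) :
    ∃ f : MvPolynomial ι ℝ, MvPolynomial.eval p₀ f ≠ 0 ∧ ∀ p, MvPolynomial.eval p f ≠ 0 →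
      Controllable (A.map (MvPolynomial.eval p)) (B.map (MvPolynomial.eval p)) := by
  obtain ⟨g, hg⟩ := controllable_iff_exists_det_ne_zero.1 h
  have key : ∀ p, MvPolynomial.eval p (kalmanSubmatrix A B g).det =
      (kalmanSubmatrix (A.map (MvPolynomial.eval p)) (B.map (MvPolynomial.eval p)) g).det := by
    intro p
    rw [RingHom.map_det]
    congr 1
    ext i r
    simp only [kalmanSubmatrix, RingHom.mapMatrix_apply, Matrix.map_apply, Matrix.of_apply]
    rw [← Matrix.map_apply (f := MvPolynomial.eval p), Matrix.map_mul, Matrix.map_pow]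
  exact ⟨_, by rwa [key], fun p hp => controllable_iff_exists_det_ne_zero.2 ⟨g, by rwa [← key]⟩⟩

namespace LTISystem

variable {nu nx ny nx' : ℕ}

theorem state_eq_sum (S : LTISystem nu nx ny) (u : ℕ → Fin nu → ℝ) (k : ℕ) :
    S.state u k = ∑ j ∈ Finset.range k, (S.A ^ (k - 1 - j) * S.B) *ᵥ u j := by
  induction k with
  | zero => simp [state]
  | succ k ih =>
    rw [state, ih, Matrix.mulVec_sum, Finset.sum_range_succ]
    congr 1
    · refine Finset.sum_congr rfl fun j hj => ?_
      rw [Matrix.mulVec_mulVec, ← Matrix.mul_assoc, ← pow_succ']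
      have := Finset.mem_range.1 hj
      congr 3
      omega
    · simp

/-- Systems are equivalent if and only if they have the same Markov parameters `D` and `C A^k B`:
these are the responses to impulses, and they determine all outputs. -/
theorem equivalent_iff_markov {S : LTISystem nu nx ny} {S' : LTISystem nu nx' ny} :
    S.Equivalent S' ↔ S.D = S'.D ∧ ∀ k, S.C * S.A ^ k * S.B = S'.C * S'.A ^ k * S'.B := by
  have hmark : ∀ {n : ℕ} (T : LTISystem nu n ny) (u : ℕ → Fin nu → ℝ) (k : ℕ),
      T.output u k = ∑ j ∈ Finset.range k, (T.C * T.A ^ (k - 1 - j) * T.B) *ᵥ u j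
        + T.D *ᵥ u k := fun T u k => by
    simp only [output, state_eq_sum, Matrix.mulVec_sum, Matrix.mulVec_mulVec, Matrix.mul_assoc]
  constructor
  · intro h
    constructor
    · refine Matrix.toLin'.injective (LinearMap.ext fun v => ?_)
      simpa [hmark] using h (fun _ => v) 0
    · intro k
      refine Matrix.toLin'.injective (LinearMap.ext fun v => ?_)
      have := h (fun j => if j = 0 then v else 0) (k + 1)
      simp only [Matrix.toLin'_apply]
      simpa [hmark, Finset.sum_range_succ', Matrix.mulVec_zero] using this
  · rintro ⟨hD, hM⟩ u k
    simp only [hmark, hD, hM]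

/-- The dual system, with all four matrices transposed and inputs and outputs exchanged. -/
def transpose (S : LTISystem nu nx ny) : LTISystem ny nx nu :=
  ⟨S.Aᵀ, S.Cᵀ, S.Bᵀ, S.Dᵀ⟩

theorem Equivalent.transpose {S : LTISystem nu nx ny} {S' : LTISystem nu nx' ny}
    (h : S.Equivalent S') : S.transpose.Equivalent S'.transpose := by
  rw [equivalent_iff_markov] at h ⊢
  refine ⟨congrArg Matrix.transpose h.1, fun k => ?_⟩
  have := congrArg Matrix.transpose (h.2 k)
  simpa [LTISystem.transpose, Matrix.transpose_mul, Matrix.transpose_pow, Matrix.mul_assoc]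
    using this

theorem IsMinimal.transpose {S : LTISystem nu nx ny} (h : S.IsMinimal) :
    S.transpose.IsMinimal :=
  fun nx' S' hS => h nx' S'.transpose hS.transpose

/-- An invertible product of observability rows and controllability columns has entries
`C A^k B`. For an equivalent system with `nx'` states the same matrix factors through dimension
`nx'`, hence `nx ≤ nx'`. -/
theorem isMinimal_of_controllable {S : LTISystem nu nx ny} (hc : Controllable S.A S.B)
    (ho : Controllable S.Aᵀ S.Cᵀ) : S.IsMinimal := by
  intro nx' S' hS
  obtain ⟨g, hg⟩ := controllable_iff_exists_det_ne_zero.1 hc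
  obtain ⟨g', hg'⟩ := controllable_iff_exists_det_ne_zero.1 ho
  have hM := (equivalent_iff_markov.1 hS).2
  have hentry : ∀ {n : ℕ} (T : LTISystem nu n ny) (s r : Fin nx),
      ((kalmanSubmatrix T.Aᵀ T.Cᵀ g')ᵀ * kalmanSubmatrix T.A T.B g) s r =
        (T.C * T.A ^ ((g' s).1 + (g r).1) * T.B) (g' s).2 (g r).2 := fun T s r => by
    rw [pow_add, ← Matrix.mul_assoc, Matrix.mul_assoc _ _ T.B, Matrix.mul_apply, Matrix.mul_apply]
    refine Finset.sum_congr rfl fun i _ => ?_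
    simp only [kalmanSubmatrix, Matrix.transpose_apply, Matrix.of_apply]
    rw [← Matrix.transpose_pow, ← Matrix.transpose_mul, Matrix.transpose_apply]
  have heq : (kalmanSubmatrix S.Aᵀ S.Cᵀ g')ᵀ * kalmanSubmatrix S.A S.B g =
      (kalmanSubmatrix S'.Aᵀ S'.Cᵀ g')ᵀ * kalmanSubmatrix S'.A S'.B g := by
    ext s r
    rw [hentry, hentry, hM]
  have hrank : ((kalmanSubmatrix S.Aᵀ S.Cᵀ g')ᵀ * kalmanSubmatrix S.A S.B g).rank = nx := by
    rw [Matrix.rank_of_isUnit, Fintype.card_fin]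
    rw [Matrix.isUnit_iff_isUnit_det, Matrix.det_mul, Matrix.det_transpose]
    exact (mul_ne_zero hg' hg).isUnit
  calc nx = _ := hrank.symm
    _ ≤ ((kalmanSubmatrix S'.Aᵀ S'.Cᵀ g')ᵀ).rank := by rw [heq]; exact Matrix.rank_mul_le_left _ _
    _ ≤ nx' := by simpa using Matrix.rank_le_card_width (kalmanSubmatrix S'.Aᵀ S'.Cᵀ g')ᵀ

/-- Restricting a system to its reachable subspace gives an equivalent system, so that the reachable
subspace of a minimal system is everything. -/
theorem IsMinimal.controllable {S : LTISystem nu nx ny} (h : S.IsMinimal) :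
    Controllable S.A S.B := by
  intro z hz
  let W : Submodule ℝ (Fin nx → ℝ) :=
    Submodule.span ℝ (Set.range fun a : ℕ × Fin nu => (S.A ^ a.1 * S.B).col a.2)
  have hgen : ∀ k a, (S.A ^ k * S.B).col a ∈ W := fun k a => Submodule.subset_span ⟨(k, a), rfl⟩
  have hinv : ∀ w ∈ W, S.A *ᵥ w ∈ W := fun w hw => by
    change w ∈ W.comap (Matrix.mulVecLin S.A)
    refine (Submodule.span_le.2 ?_ : W ≤ _) hw
    rintro _ ⟨a, rfl⟩
    convert hgen (a.1 + 1) a.2 using 1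
    rw [pow_succ', Matrix.mul_assoc]
    rfl
  let b := Module.finBasis ℝ W
  let P : Matrix (Fin nx) (Fin (Module.finrank ℝ W)) ℝ := Matrix.of fun i r => (b r : Fin nx → ℝ) i
  have hcoord : ∀ w ∈ W, ∃ c, w = P *ᵥ c := fun w hw => by
    refine ⟨b.repr ⟨w, hw⟩, ?_⟩
    have := congrArg (Subtype.val : W → _) (b.sum_repr ⟨w, hw⟩)
    refine Eq.trans this.symm (funext fun i => ?_)
    simp [-Module.Basis.sum_repr, Matrix.mulVec, dotProduct, P, mul_comm]
  choose A' hA' using fun r => hcoord _ (hinv _ (b r).2)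
  choose B' hB' using fun a => hcoord _ (hgen 0 a)
  let S' : LTISystem nu (Module.finrank ℝ W) ny :=
    ⟨(Matrix.of A')ᵀ, (Matrix.of B')ᵀ, S.C * P, S.D⟩
  -- `P` intertwines the restricted system with `S`
  have hA : S.A * P = P * S'.A := by
    ext i r
    exact congrFun (hA' r) i
  have hB : S.B = P * S'.B := by
    ext i a
    have := congrFun (hB' a) i
    rw [pow_zero, Matrix.one_mul] at this
    exact this
  have hstate : ∀ u k, S.state u k = P *ᵥ S'.state u k := by
    intro u k
    induction k with
    | zero => simp [state]
    | succ k ih =>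
      rw [state, state, ih, Matrix.mulVec_add, Matrix.mulVec_mulVec, Matrix.mulVec_mulVec,
        Matrix.mulVec_mulVec, hA, ← hB]
  have hle := h _ S' fun u k => by
    simp only [output, hstate, S', Matrix.mulVec_mulVec]
  have htop : W = ⊤ := by
    refine Submodule.eq_top_of_finrank_eq (le_antisymm (Submodule.finrank_le _) ?_)
    simpa using hle
  have hzW : ∀ w ∈ W, z ⬝ᵥ w = 0 := fun w hw => by
    change w ∈ LinearMap.ker (dotProductBilin ℝ ℝ z)
    refine (Submodule.span_le.2 ?_ : W ≤ _) hw
    rintro _ ⟨a, rfl⟩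
    exact congrFun (hz a.1) a.2
  exact dotProduct_self_eq_zero.1 (hzW z (htop ▸ Submodule.mem_top))

end LTISystem

/-! ### Lists of vertices that are paths or cycles -/

section PathLists

variable {V V' : Type*} {G : Digraph V}

theorem Digraph.isPathList_of_nodup {l : List V} (hne : l ≠ []) (hc : l.IsChain G.Adj)
    (hnd : l.Nodup) : G.IsPathList l :=
  ⟨hne, hc, fun _ _ hij _ h => absurd (hnd.getElem_inj_iff.1 h) hij.ne⟩

theorem Digraph.isSimplePathList_of_nodup {l : List V} (hne : l ≠ []) (hc : l.IsChain G.Adj)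
    (hnd : l.Nodup) : G.IsSimplePathList l := by
  refine ⟨isPathList_of_nodup hne hc hnd, fun ⟨_, h2, h⟩ => ?_⟩
  rw [List.head?_eq_getElem?, List.getLast?_eq_getElem?, List.getElem?_eq_getElem (by omega),
    List.getElem?_eq_getElem (by omega), Option.some_inj, hnd.getElem_inj_iff] at h
  omega

theorem Digraph.exists_isPathList_iff {a b : V} :
    (∃ l, G.IsPathList l ∧ l.head? = some a ∧ l.getLast? = some b) ↔
      Relation.ReflTransGen G.Adj a b := by
  constructor
  · rintro ⟨l, ⟨hne, hc, -⟩, ha, hb⟩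
    rw [List.head?_eq_some_head hne, Option.some_inj] at ha
    rw [List.getLast?_eq_some_getLast hne, Option.some_inj] at hb
    rw [← ha, ← hb]
    exact List.relationReflTransGen_of_exists_isChain l hc hne
  · intro h
    suffices ∃ l : List V, l.Nodup ∧ l.IsChain G.Adj ∧ l.head? = some a ∧ l.getLast? = some b by
      obtain ⟨l, hnd, hc, ha, hb⟩ := this
      exact ⟨l, isPathList_of_nodup (by rintro rfl; simp at ha) hc hnd, ha, hb⟩
    induction h with
    | refl => exact ⟨[a], by simp⟩
    | @tail b c _ hbc ih =>
      obtain ⟨l, hnd, hc, ha, hb⟩ := ih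
      by_cases hcl : c ∈ l
      · -- cut the list at the first occurrence of `c`
        obtain ⟨s, t, rfl⟩ := List.append_of_mem hcl
        have hsub : (s ++ [c]).Sublist (s ++ c :: t) := by simp
        refine ⟨s ++ [c], hnd.sublist hsub, (List.isChain_split.1 hc).1, ?_, by simp⟩
        cases s <;> simpa using ha
      · refine ⟨l ++ [c], ?_, ?_, ?_, by simp⟩
        · rw [List.nodup_append]
          simpa [hnd] using fun x hx (h : x = c) => hcl (h ▸ hx)
        · rw [List.isChain_append]
          simp [hc, hb, hbc]
        · cases l <;> simp_all

variable {G' : Digraph V'}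

/-- An injective map of vertices that reverses edges takes paths to reversed paths. -/
theorem Digraph.IsPathList.map_reverse {φ : V → V'} (hφ : Function.Injective φ)
    (hadj : ∀ v w, G.Adj v w → G'.Adj (φ w) (φ v)) {l : List V} (h : G.IsPathList l) :
    G'.IsPathList (l.map φ).reverse := by
  obtain ⟨hne, hc, hinj⟩ := h
  refine ⟨by simpa using hne, ?_, fun i j hij hj heq => ?_⟩
  · rw [List.isChain_reverse, List.isChain_map]
    exact hc.imp fun v w => hadj v w
  · simp only [List.length_reverse, List.length_map] at hj
    simp only [List.getElem_reverse, List.getElem_map, List.length_map] at heq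
    have := hinj _ _ (by omega) (by omega) (hφ heq).symm
    simp only [List.length_reverse, List.length_map]
    omega

theorem Digraph.IsCycleList.map_reverse {φ : V → V'} (hφ : Function.Injective φ)
    (hadj : ∀ v w, G.Adj v w → G'.Adj (φ w) (φ v)) {l : List V} (h : G.IsCycleList l) :
    G'.IsCycleList (l.map φ).reverse := by
  refine ⟨h.1.map_reverse hφ hadj, by simpa using h.2.1, ?_⟩
  simp [h.2.2]

theorem Digraph.IsSimplePathList.map_reverse {φ : V → V'} (hφ : Function.Injective φ)
    (hadj : ∀ v w, G.Adj v w → G'.Adj (φ w) (φ v)) {l : List V} (h : G.IsSimplePathList l) :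
    G'.IsSimplePathList (l.map φ).reverse := by
  refine ⟨h.1.map_reverse hφ hadj, fun hc => h.2 ⟨h.1, by simpa using hc.2.1, ?_⟩⟩
  have := hc.2.2
  simp only [List.head?_reverse, List.getLast?_reverse, List.head?_map, List.getLast?_map] at this
  exact (Option.map_injective hφ this).symm

theorem disjoint_map_reverse {φ : V → V'} (hφ : Function.Injective φ) {l l' : List V}
    (h : l.Disjoint l') : (l.map φ).reverse.Disjoint (l'.map φ).reverse := by
  simpa using (List.disjoint_map hφ h)

theorem Digraph.IsPathFamily.image_map_reverse {φ : V → V'} (hφ : Function.Injective φ)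
    (hadj : ∀ v w, G.Adj v w → G'.Adj (φ w) (φ v)) {F : Set (List V)} (h : G.IsPathFamily F) :
    G'.IsPathFamily ((fun l => (l.map φ).reverse) '' F) := by
  refine ⟨?_, ?_⟩
  · rintro _ ⟨l, hl, rfl⟩
    exact (h.1 l hl).map_reverse hφ hadj
  · rintro _ ⟨l, hl, rfl⟩ _ ⟨l', hl', rfl⟩ hne
    exact disjoint_map_reverse hφ (h.2 hl hl' fun e => hne (by rw [e]))

theorem Digraph.IsCycleFamily.image_map_reverse {φ : V → V'} (hφ : Function.Injective φ)
    (hadj : ∀ v w, G.Adj v w → G'.Adj (φ w) (φ v)) {F : Set (List V)} (h : G.IsCycleFamily F) :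
    G'.IsCycleFamily ((fun l => (l.map φ).reverse) '' F) := by
  refine ⟨?_, ?_⟩
  · rintro _ ⟨l, hl, rfl⟩
    exact (h.1 l hl).map_reverse hφ hadj
  · rintro _ ⟨l, hl, rfl⟩ _ ⟨l', hl', rfl⟩ hne
    exact disjoint_map_reverse hφ (h.2 hl hl' fun e => hne (by rw [e]))

end PathLists

/-! ### The graph of a structured system, and predecessor maps -/

section Graph

open SysVertex

namespace StructuredSystem

variable {nu nx ny : ℕ}

/-- `S.FreeInto i v`: the entry of `[A B]` in row `i` and the column of `v` is free. The columns are
indexed by the states and inputs, so this says that the graph has the edge from `v` to `x_i`. -/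
def FreeInto (S : StructuredSystem nu nx ny) (i : Fin nx) : Fin nx ⊕ Fin nu → Prop
  | Sum.inl j => (i, j) ∉ S.TA
  | Sum.inr a => (i, a) ∉ S.TB

variable {S : StructuredSystem nu nx ny}

theorem structuredMatrix_one_ne_zero {m n : ℕ} {T : Set (Fin m × Fin n)} {i : Fin m} {j : Fin n} :
    structuredMatrix T (fun _ => 1) i j ≠ 0 ↔ (i, j) ∉ T := by
  by_cases h : (i, j) ∈ T <;> simp [structuredMatrix, h]

theorem graph_adj_x {v : Fin nx ⊕ Fin nu} {i : Fin nx} :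
    S.graph.Adj (Sum.inl v) (x i) ↔ S.FreeInto i v := by
  cases v <;> exact structuredMatrix_one_ne_zero

theorem graph_adj_x_y {i : Fin nx} {j : Fin ny} :
    S.graph.Adj (x i) (y j) ↔ (j, i) ∉ S.TC := structuredMatrix_one_ne_zero

theorem graph_adj_u_y {a : Fin nu} {j : Fin ny} :
    S.graph.Adj (u a) (y j) ↔ (j, a) ∉ S.TD := structuredMatrix_one_ne_zero

theorem not_graph_adj_u (w : SysVertex nu nx ny) (a : Fin nu) : ¬ S.graph.Adj w (u a) := by
  rcases w with (_ | _) | _ <;> exact fun h => h rfl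

theorem not_graph_adj_of_y (j : Fin ny) (w : SysVertex nu nx ny) : ¬ S.graph.Adj (y j) w := by
  rcases w with (_ | _) | _ <;> exact fun h => h rfl

theorem exists_freeInto_of_adj_x {w : SysVertex nu nx ny} {i : Fin nx}
    (h : S.graph.Adj w (x i)) : ∃ v, w = Sum.inl v ∧ S.FreeInto i v := by
  rcases w with v | j
  · exact ⟨v, rfl, graph_adj_x.1 h⟩
  · exact absurd h (not_graph_adj_of_y j _)

theorem exists_uRooted_iff {i : Fin nx} :
    (∃ l, S.graph.IsPathList l ∧ URooted l ∧ l.getLast? = some (x i)) ↔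
      ∃ a, Relation.ReflTransGen S.graph.Adj (u a) (x i) := by
  simp only [← Digraph.exists_isPathList_iff, URooted]
  exact ⟨fun ⟨l, hl, ⟨a, ha⟩, h⟩ => ⟨a, l, hl, ha, h⟩, fun ⟨a, l, hl, ha, h⟩ => ⟨l, hl, ⟨a, ha⟩, h⟩⟩

/-- A covering of the states by disjoint paths that start at inputs and by cycles gives an injective
choice of a predecessor for each state: the vertex before it in the path or cycle that covers it. -/
theorem exists_injective_of_families {F₁ F₂ : Set (List (SysVertex nu nx ny))}
    (h₁ : S.graph.IsPathFamily F₁) (hU : ∀ l ∈ F₁, URooted l) (h₂ : S.graph.IsCycleFamily F₂)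
    (hd : FamiliesDisjoint F₁ F₂) (hcov : ∀ i : Fin nx, FamilyCovers (F₁ ∪ F₂) (x i)) :
    ∃ σ : Fin nx → Fin nx ⊕ Fin nu, Function.Injective σ ∧ ∀ i, S.FreeInto i (σ i) := by
  have hpath : ∀ l ∈ F₁ ∪ F₂, S.graph.IsPathList l := by
    rintro l (hl | hl)
    exacts [(h₁.1 l hl).1, (h₂.1 l hl).1]
  have hdisj : ∀ l ∈ F₁ ∪ F₂, ∀ l' ∈ F₁ ∪ F₂, ∀ v ∈ l, v ∈ l' → l = l' := by
    intro l hl l' hl' v hv hv'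
    by_contra hne
    rcases hl with hl | hl <;> rcases hl' with hl' | hl'
    · exact h₁.2 hl hl' hne hv hv'
    · exact hd l hl l' hl' hv hv'
    · exact hd l' hl' l hl hv' hv
    · exact h₂.2 hl hl' hne hv hv'
  have key : ∀ i : Fin nx, ∃ l ∈ F₁ ∪ F₂, ∃ (k : ℕ) (hk : k + 1 < l.length), l[k + 1] = x i := by
    intro i
    obtain ⟨l, hl, hi⟩ := hcov i
    obtain ⟨k, hk, hki⟩ := List.getElem_of_mem hi
    refine ⟨l, hl, ?_⟩
    rcases k with _ | k
    · rcases hl with hl | hl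
      · obtain ⟨a, ha⟩ := hU l hl
        rw [List.head?_eq_getElem?, List.getElem?_eq_getElem hk, hki] at ha
        simp [x, u] at ha
      · -- the first vertex of a cycle is also its last one
        obtain ⟨_, h2, h⟩ := h₂.1 l hl
        refine ⟨l.length - 2, by omega, ?_⟩
        rw [List.head?_eq_getElem?, List.getLast?_eq_getElem?, List.getElem?_eq_getElem hk,
          List.getElem?_eq_getElem (by omega), Option.some_inj] at h
        rw [← hki, h]
        congr 1
        omega
    · exact ⟨k, hk, hki⟩
  choose l hl k hk hki using key
  -- the predecessor of `x i` is the entry `k i` of the list `l i`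
  have hadj : ∀ i, S.graph.Adj ((l i)[k i]'(by have := hk i; omega)) (x i) := fun i => by
    rw [← hki i]
    exact List.isChain_iff_getElem.1 (hpath _ (hl i)).2.1 _ (hk i)
  choose σ hσ hfree using fun i => exists_freeInto_of_adj_x (hadj i)
  refine ⟨σ, fun i j hij => ?_, hfree⟩
  have hv : (l i)[k i]'(by have := hk i; omega) = (l j)[k j]'(by have := hk j; omega) := by
    rw [hσ, hσ, hij]
  have hlij : l i = l j := hdisj _ (hl i) _ (hl j) _ (List.getElem_mem _)
    (by rw [hv]; exact List.getElem_mem _)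
  have hkj := hk j
  have hkij : k i = k j := by
    simp only [hlij] at hv
    have hlen := congrArg List.length hlij
    have hki' := hk i
    rcases lt_trichotomy (k i) (k j) with h | h | h
    · have := ((hpath _ (hl j)).2.2 _ _ h (by omega) hv).2
      omega
    · exact h
    · have := ((hpath _ (hl j)).2.2 _ _ h (by omega) hv.symm).2
      omega
  have := (hki i).symm.trans ((by simp only [hlij, hkij]) : _ = _) |>.trans (hki j)
  simpa [x] using this

end StructuredSystem

end Graph

/-! ### Families of paths and cycles from an injective predecessor map -/

section Families

open SysVertex Function

variable {nu nx ny : ℕ}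

/-- The orbit segment `v, τ v, …, τ^(n-1) v`, as a list of vertices of the graph. -/
def iterateList (τ : Equiv.Perm (Fin nx ⊕ Fin nu)) (v : Fin nx ⊕ Fin nu) (n : ℕ) :
    List (SysVertex nu nx ny) :=
  (List.range n).map fun k => Sum.inl (τ^[k] v)

theorem mem_iterateList {τ : Equiv.Perm (Fin nx ⊕ Fin nu)} {v : Fin nx ⊕ Fin nu} {n : ℕ}
    {w : SysVertex nu nx ny} :
    w ∈ iterateList τ v n ↔ ∃ k < n, Sum.inl (τ^[k] v) = w := by
  simp [iterateList]

theorem isChain_iterateList {S : StructuredSystem nu nx ny} {τ : Equiv.Perm (Fin nx ⊕ Fin nu)}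
    (hτ : ∀ v i, τ v = Sum.inl i → S.FreeInto i v) {v : Fin nx ⊕ Fin nu} {n : ℕ}
    (hv : ∀ k, k + 1 < n → ∃ i, τ^[k + 1] v = Sum.inl i) :
    (iterateList τ v n).IsChain S.graph.Adj := by
  refine List.isChain_iff_getElem.2 fun k hk => ?_
  simp only [iterateList, List.length_map, List.length_range] at hk
  obtain ⟨i, hi⟩ := hv k hk
  simp only [iterateList, List.getElem_map, List.getElem_range, hi]
  exact StructuredSystem.graph_adj_x.2 (hτ _ _ (by rw [← hi, iterate_succ_apply']))

theorem sameCycle_iterate (τ : Equiv.Perm (Fin nx ⊕ Fin nu)) (v : Fin nx ⊕ Fin nu) (k : ℕ) :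
    τ.SameCycle v (τ^[k] v) := ⟨k, by simp [Equiv.Perm.iterate_eq_pow]⟩

/-- An injective choice `σ` of predecessors gives a covering of the states by disjoint paths that
start at inputs and by cycles. Extend the inverse of `σ` to a permutation `τ` of the states and
inputs. The orbit segments from an input up to, and excluding, the next input are the paths; the
orbits that contain no input are the cycles. -/
theorem StructuredSystem.exists_families_of_injective {S : StructuredSystem nu nx ny}
    {σ : Fin nx → Fin nx ⊕ Fin nu} (hσ : Injective σ) (hfree : ∀ i, S.FreeInto i (σ i)) :
    ∃ F₁ F₂ : Set (List (SysVertex nu nx ny)),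
        S.graph.IsPathFamily F₁ ∧ (∀ l ∈ F₁, URooted l) ∧
        S.graph.IsCycleFamily F₂ ∧ FamiliesDisjoint F₁ F₂ ∧
        ∀ i : Fin nx, FamilyCovers (F₁ ∪ F₂) (x i) := by
  classical
  obtain ⟨τ, hτσ⟩ : ∃ τ : Equiv.Perm (Fin nx ⊕ Fin nu), ∀ i, τ (σ i) = Sum.inl i := by
    let e := (Equiv.ofInjective σ hσ).symm.trans
      (Equiv.ofInjective (Sum.inl : Fin nx → Fin nx ⊕ Fin nu) Sum.inl_injective)
    refine ⟨Equiv.extendSubtype (p := (· ∈ Set.range σ)) (q := (· ∈ Set.range Sum.inl)) e,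
      fun i => ?_⟩
    rw [Equiv.extendSubtype_apply_of_mem _ _ ⟨i, rfl⟩]
    change (Equiv.ofInjective Sum.inl Sum.inl_injective ((Equiv.ofInjective σ hσ).symm
      (Equiv.ofInjective σ hσ i))).1 = _
    rw [Equiv.symm_apply_apply]
    rfl
  have hτ : ∀ v i, τ v = Sum.inl i → S.FreeInto i v := fun v i h => by
    rw [τ.injective (h.trans (hτσ i).symm)]
    exact hfree i
  have hper : ∀ v, 0 < minimalPeriod τ v := fun v =>
    minimalPeriod_pos_of_mem_periodicPts (τ.injective.mem_periodicPts v)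
  -- the time of first return to the inputs
  have hret : ∀ a : Fin nu, ∃ k, 0 < k ∧ ∃ b : Fin nu, τ^[k] (Sum.inr a) = Sum.inr b :=
    fun a => ⟨_, hper (Sum.inr a), a, iterate_minimalPeriod⟩
  let len : Fin nu → ℕ := fun a => Nat.find (hret a)
  have hlen_pos : ∀ a, 0 < len a := fun a => (Nat.find_spec (hret a)).1
  have hlen_min : ∀ a b k, 0 < k → k < len a → τ^[k] (Sum.inr a) ≠ Sum.inr b := fun a b k h0 hk h =>
    Nat.find_min (hret a) hk ⟨h0, b, h⟩
  have hstate : ∀ a k, 0 < k → k < len a → ∃ i, τ^[k] (Sum.inr a) = Sum.inl i := fun a k h0 hk => by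
    rcases h : τ^[k] (Sum.inr a) with i | b
    · exact ⟨i, rfl⟩
    · exact absurd h (hlen_min a b k h0 hk)
  have haux : ∀ a b i j, i ≤ j → j < len b → τ^[i] (Sum.inr a) = τ^[j] (Sum.inr b) →
      a = b ∧ i = j := fun a b i j hij hj h => by
    obtain ⟨d, rfl⟩ := Nat.exists_eq_add_of_le hij
    rw [iterate_add_apply] at h
    have h' := (τ.injective.iterate i) h
    rcases Nat.eq_zero_or_pos d with rfl | hd
    · exact ⟨Sum.inr_injective h', rfl⟩
    · exact absurd h'.symm (hlen_min b a d hd (by omega))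
  have huniq : ∀ a b i j, i < len a → j < len b → τ^[i] (Sum.inr a) = τ^[j] (Sum.inr b) →
      a = b ∧ i = j := fun a b i j hi hj h => by
    rcases le_total i j with hij | hij
    · exact haux a b i j hij hj h
    · obtain ⟨h1, h2⟩ := haux b a j i hij hi h.symm
      exact ⟨h1.symm, h2.symm⟩
  -- one starting point for each orbit, so that each cycle occurs as one list only
  let rep : Fin nx ⊕ Fin nu → Fin nx ⊕ Fin nu := fun v =>
    (Quotient.mk (Equiv.Perm.SameCycle.setoid τ) v).out
  have hrep : ∀ v, τ.SameCycle (rep v) v := fun v =>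
    Quotient.mk_out (s := Equiv.Perm.SameCycle.setoid τ) v
  have hrep_eq : ∀ v w, τ.SameCycle v w → rep v = rep w := fun v w h =>
    congrArg Quotient.out (Quotient.sound (s := Equiv.Perm.SameCycle.setoid τ) h)
  refine ⟨Set.range fun a => iterateList τ (Sum.inr a) (len a),
    {l | ∃ v, (∀ a, ¬ τ.SameCycle v (Sum.inr a)) ∧
      l = iterateList τ (rep v) (minimalPeriod τ (rep v) + 1)}, ⟨?_, ?_⟩, ?_, ⟨?_, ?_⟩, ?_, ?_⟩
  · rintro _ ⟨a, rfl⟩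
    refine Digraph.isSimplePathList_of_nodup ?_
      (isChain_iterateList hτ fun k hk => hstate a (k + 1) k.succ_pos hk) ?_
    · exact List.ne_nil_of_mem (mem_iterateList.2 ⟨0, hlen_pos a, rfl⟩)
    · refine (List.nodup_map_iff_inj_on List.nodup_range).2 fun i hi j hj h => ?_
      exact (huniq a a i j (List.mem_range.1 hi) (List.mem_range.1 hj) (Sum.inl_injective h)).2
  · rintro _ ⟨a, rfl⟩ _ ⟨b, rfl⟩ hne w hw hw'
    obtain ⟨i, hi, rfl⟩ := mem_iterateList.1 hw
    obtain ⟨j, hj, h⟩ := mem_iterateList.1 hw'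
    exact hne (by rw [(huniq a b i j hi hj (Sum.inl_injective h.symm)).1])
  · rintro _ ⟨a, rfl⟩
    refine ⟨a, ?_⟩
    simp [iterateList, List.head?_range, (hlen_pos a).ne', u]
  · rintro _ ⟨v, hv, rfl⟩
    have hlist : (iterateList τ (rep v) (minimalPeriod τ (rep v) + 1) :
        List (SysVertex nu nx ny)).length = minimalPeriod τ (rep v) + 1 := by simp [iterateList]
    refine ⟨⟨?_, isChain_iterateList hτ fun k _ => ?_, fun i j hij hj h => ?_⟩, ?_, ?_⟩
    · exact List.ne_nil_of_mem (mem_iterateList.2 ⟨0, Nat.succ_pos _, rfl⟩)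
    · rcases h : τ^[k + 1] (rep v) with i | a
      · exact ⟨i, rfl⟩
      · exact absurd ((hrep v).symm.trans (h ▸ sameCycle_iterate τ (rep v) (k + 1))) (hv a)
    · rw [hlist] at hj ⊢
      simp only [iterateList, List.getElem_map, List.getElem_range, Sum.inl.injEq] at h
      rcases Nat.lt_succ_iff_lt_or_eq.1 hj with hj' | rfl
      · exact absurd (iterate_injOn_Iio_minimalPeriod (hij.trans hj') hj' h) hij.ne
      · rw [iterate_minimalPeriod] at h
        exact ⟨iterate_injOn_Iio_minimalPeriod hij (hper _) h, rfl⟩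
    · have := hper (rep v)
      omega
    · simp [iterateList, List.head?_range, List.getLast?_range, iterate_minimalPeriod]
  · rintro _ ⟨v, hv, rfl⟩ _ ⟨v', hv', rfl⟩ hne w hw hw'
    obtain ⟨i, hi, rfl⟩ := mem_iterateList.1 hw
    obtain ⟨j, hj, h⟩ := mem_iterateList.1 hw'
    refine hne ?_
    rw [hrep_eq v v' ?_]
    have h1 := (hrep v).symm.trans (sameCycle_iterate τ (rep v) i)
    have h2 := (hrep v').symm.trans (sameCycle_iterate τ (rep v') j)
    rw [Sum.inl_injective h] at h2
    exact h1.trans h2.symm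
  · rintro _ ⟨a, rfl⟩ _ ⟨v, hv, rfl⟩ w hw hw'
    obtain ⟨i, hi, rfl⟩ := mem_iterateList.1 hw
    obtain ⟨j, hj, h⟩ := mem_iterateList.1 hw'
    have h2 := (hrep v).symm.trans (sameCycle_iterate τ (rep v) j)
    rw [Sum.inl_injective h] at h2
    exact hv a (h2.trans (sameCycle_iterate τ _ i).symm)
  · intro i
    by_cases hi : ∃ a, τ.SameCycle (Sum.inl i) (Sum.inr a)
    · have hex : ∃ k a, τ^[k] (Sum.inr a) = Sum.inl i := by
        obtain ⟨a, ha⟩ := hi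
        obtain ⟨k, hk⟩ := ha.symm.exists_nat_pow_eq
        exact ⟨k, a, by rwa [Equiv.Perm.iterate_eq_pow]⟩
      -- the input from which the state is reached soonest reaches it before the next input
      obtain ⟨a, ha⟩ := Nat.find_spec hex
      refine ⟨_, Or.inl ⟨a, rfl⟩, mem_iterateList.2 ⟨Nat.find hex, ?_, by rw [ha]; rfl⟩⟩
      by_contra hle
      obtain ⟨b, hb⟩ := (Nat.find_spec (hret a)).2
      refine Nat.find_min hex (m := Nat.find hex - len a) ?_ ⟨b, ?_⟩
      · have := hlen_pos a
        omega
      · rw [← hb, ← iterate_add_apply]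
        change τ^[Nat.find hex - len a + len a] _ = _
        rwa [Nat.sub_add_cancel (not_lt.1 hle)]
    · push Not at hi
      refine ⟨_, Or.inr ⟨Sum.inl i, hi, rfl⟩, mem_iterateList.2 ?_⟩
      obtain ⟨k, hk⟩ := (hrep (Sum.inl i)).exists_nat_pow_eq
      refine ⟨k % minimalPeriod τ (rep (Sum.inl i)), ?_, ?_⟩
      · have := Nat.mod_lt k (hper (rep (Sum.inl i)))
        omega
      · rw [iterate_mod_minimalPeriod_eq, Equiv.Perm.iterate_eq_pow, hk]
        rfl

end Families

/-! ### Exclusion of large resonant eigenvalues -/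

section Resonance

variable {E F : Type*} [NormedAddCommGroup E] [NormedSpace ℂ E] [FiniteDimensional ℂ E]
  [NormedAddCommGroup F] [NormedSpace ℂ F]

/-- Feed an external mode `μ` into a system with row action `L` and input map `β`, through the state
row `e` and the input row `f`. If the Markov parameters `f, β e, β (L e), …` seen by that mode do
not all vanish, then for large `μ` no row vector `z` cancels them: the equation `L z + e = μ z`
makes `z` of order `1 / μ`, while `β (L ^ k z)` is the negative of the first nonzero Markov
parameter. -/
theorem exists_bound_resonance (L : E →ₗ[ℂ] E) (β : E →ₗ[ℂ] F) (e : E) (f : F)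
    (h : f ≠ 0 ∨ ∃ k, β ((L ^ k) e) ≠ 0) :
    ∃ T : ℝ, ∀ (z : E) (μ : ℂ), L z + e = μ • z → β z + f = 0 → ‖μ‖ < T := by
  -- the Markov parameters
  let g : ℕ → F := fun k => Nat.casesOn k f fun k => β ((L ^ k) e)
  have hg : ∃ k, g k ≠ 0 := by
    rcases h with h | ⟨k, h⟩
    exacts [⟨0, h⟩, ⟨k + 1, h⟩]
  obtain ⟨k, hk, hlt⟩ : ∃ k, g k ≠ 0 ∧ ∀ j < k, g j = 0 := by
    have := Classical.decPred fun k => g k ≠ 0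
    exact ⟨Nat.find hg, Nat.find_spec hg, fun j hj => not_not.1 (Nat.find_min hg hj)⟩
  let L' := LinearMap.toContinuousLinearMap L
  let β' := LinearMap.toContinuousLinearMap (β ∘ₗ L ^ k)
  refine ⟨‖L'‖ + ‖β'‖ * ‖e‖ / ‖g k‖ + 1, fun z μ hz hf => ?_⟩
  have hind : ∀ j ≤ k, β ((L ^ j) z) = - g j := by
    intro j hj
    induction j with
    | zero => exact eq_neg_of_add_eq_zero_left hf
    | succ j ih =>
      have h0 := ih (by omega)
      rw [hlt j (by omega), neg_zero] at h0
      rw [pow_succ, Module.End.mul_apply, eq_sub_of_add_eq hz, map_sub, map_sub, map_smul, map_smul,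
        h0, smul_zero, zero_sub]
  have h1 : ‖g k‖ ≤ ‖β'‖ * ‖z‖ := by
    rw [← norm_neg, ← hind k le_rfl]
    exact β'.le_opNorm z
  have h2 : ‖μ‖ * ‖z‖ ≤ ‖L'‖ * ‖z‖ + ‖e‖ := by
    rw [← norm_smul, ← hz]
    exact (norm_add_le _ _).trans (add_le_add (L'.le_opNorm z) le_rfl)
  have hg0 : 0 < ‖g k‖ := norm_pos_iff.2 hk
  by_contra hμ
  rw [not_lt, ← sub_nonneg] at hμ
  have hd : ‖β'‖ * ‖e‖ / ‖g k‖ * ‖g k‖ = ‖β'‖ * ‖e‖ := div_mul_cancel₀ _ hg0.ne'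
  have hz0 : 0 < ‖z‖ := by
    by_contra hz0
    have : ‖z‖ = 0 := le_antisymm (not_lt.1 hz0) (norm_nonneg _)
    rw [this, mul_zero] at h1
    linarith
  have hq : 0 ≤ ‖β'‖ * ‖e‖ / ‖g k‖ := by positivity
  have h3 : (‖β'‖ * ‖e‖ / ‖g k‖ + 1) * ‖z‖ ≤ ‖e‖ := by nlinarith
  have hβ : 0 < ‖β'‖ := by
    by_contra h0
    have : ‖β'‖ = 0 := le_antisymm (not_lt.1 h0) (norm_nonneg _)
    rw [this, zero_mul] at h1
    linarith
  have h4 : ‖β'‖ * ‖e‖ / ‖g k‖ * ‖g k‖ ≤ ‖β'‖ * ‖e‖ / ‖g k‖ * (‖β'‖ * ‖z‖) :=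
    mul_le_mul_of_nonneg_left h1 hq
  have h5 : ‖β'‖ * ((‖β'‖ * ‖e‖ / ‖g k‖ + 1) * ‖z‖) ≤ ‖β'‖ * ‖e‖ :=
    mul_le_mul_of_nonneg_left h3 hβ.le
  have h6 : 0 < ‖β'‖ * ‖z‖ := mul_pos hβ hz0
  nlinarith

end Resonance

/-! ### The eigenvector test on a subset of the states -/

section Hautus

variable {n m : ℕ}

/-- The row action `z ↦ z A` of the state columns of `M = [A B]` on complex row vectors. -/
noncomputable def stateAction (M : Matrix (Fin n) (Fin n ⊕ Fin m) ℝ) :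
    (Fin n → ℂ) →ₗ[ℂ] (Fin n → ℂ) :=
  Matrix.vecMulLinear (M.toCols₁.map Complex.ofReal)

/-- The row action `z ↦ z B` of the input columns of `M = [A B]` on complex row vectors. -/
noncomputable def inputAction (M : Matrix (Fin n) (Fin n ⊕ Fin m) ℝ) :
    (Fin n → ℂ) →ₗ[ℂ] (Fin m → ℂ) :=
  Matrix.vecMulLinear (M.toCols₂.map Complex.ofReal)

variable {M : Matrix (Fin n) (Fin n ⊕ Fin m) ℝ}

theorem stateAction_apply (z : Fin n → ℂ) (j : Fin n) :
    stateAction M z j = ∑ i, z i * (M i (Sum.inl j) : ℂ) := rfl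

theorem inputAction_apply (z : Fin n → ℂ) (a : Fin m) :
    inputAction M z a = ∑ i, z i * (M i (Sum.inr a) : ℂ) := rfl

/-- The matrix `M = [A B]` is supported on the subsystem with states `R`, and this subsystem passes
the eigenvector test for controllability: no nonzero complex left eigenvector of `A` on `R` is
annihilated by `B`. -/
structure HautusOn (R : Finset (Fin n)) (M : Matrix (Fin n) (Fin n ⊕ Fin m) ℝ) : Prop where
  row_mem : ∀ i v, M i v ≠ 0 → i ∈ R
  col_mem : ∀ i j, M i (Sum.inl j) ≠ 0 → j ∈ R
  eq_zero : ∀ (μ : ℂ) (z : Fin n → ℂ), (∀ j ∈ R, stateAction M z j = μ * z j) →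
    inputAction M z = 0 → ∀ i ∈ R, z i = 0

/-- The eigenvector test implies controllability: the row vectors on `R` annihilated by all `A^k B`
form an invariant subspace, which would contain an eigenvector if it were nonzero. -/
theorem HautusOn.eq_zero_of_forall_pow {R : Finset (Fin n)} (h : HautusOn R M) {z : Fin n → ℂ}
    (hz : ∀ i ∉ R, z i = 0) (hk : ∀ k, inputAction M ((stateAction M ^ k) z) = 0) : z = 0 := by
  let W : Submodule ℂ (Fin n → ℂ) :=
    { carrier := {z | (∀ i ∉ R, z i = 0) ∧ ∀ k, inputAction M ((stateAction M ^ k) z) = 0}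
      add_mem' := fun {a b} ha hb => ⟨fun i hi => by simp [ha.1 i hi, hb.1 i hi],
        fun k => by simp [ha.2 k, hb.2 k]⟩
      zero_mem' := by simp
      smul_mem' := fun c a ha => ⟨fun i hi => by simp [ha.1 i hi], fun k => by simp [ha.2 k]⟩ }
  have hinv : ∀ w ∈ W, stateAction M w ∈ W := fun w hw => by
    refine ⟨fun i hi => ?_, fun k => ?_⟩
    · rw [stateAction_apply]
      refine Finset.sum_eq_zero fun j _ => ?_
      rw [not_not.1 (mt (h.col_mem j i) hi), Complex.ofReal_zero, mul_zero]
    · simpa [pow_succ] using hw.2 (k + 1)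
  by_contra hne
  have : Nontrivial W := ⟨⟨⟨z, hz, hk⟩, 0, fun e => hne (congrArg Subtype.val e)⟩⟩
  obtain ⟨μ, hμ⟩ := Module.End.exists_eigenvalue ((stateAction M).restrict hinv)
  obtain ⟨w, hw⟩ := hμ.exists_hasEigenvector
  have hw1 : stateAction M w = μ • (w : Fin n → ℂ) := congrArg Subtype.val hw.apply_eq_smul
  refine hw.2 (Subtype.ext (funext fun i => ?_))
  by_cases hi : i ∈ R
  · exact h.eq_zero μ w (fun j _ => congrFun hw1 j) (by simpa using w.2.2 0) i hi
  · exact w.2.1 i hi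

theorem HautusOn.controllable (h : HautusOn Finset.univ M) :
    Controllable M.toCols₁ M.toCols₂ := by
  intro z hz
  have hpow : ∀ k, (stateAction M ^ k) (fun i => (z i : ℂ)) =
      fun j => ((z ᵥ* M.toCols₁ ^ k) j : ℂ) := by
    intro k
    induction k with
    | zero => simp
    | succ k ih =>
      ext j
      rw [pow_succ', Module.End.mul_apply, ih, stateAction_apply, pow_succ, ← Matrix.vecMul_vecMul]
      simp [Matrix.vecMul, dotProduct]
  have h0 := h.eq_zero_of_forall_pow (z := fun i => (z i : ℂ)) (by simp) fun k => by
    ext a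
    have := congrFun (hz k) a
    rw [hpow, inputAction_apply]
    rw [← Matrix.vecMul_vecMul] at this
    have h' := congrArg Complex.ofReal this
    simpa [Matrix.vecMul, dotProduct] using h'
  ext i
  simpa using congrFun h0 i

end Hautus

/-! ### Construction of a controllable pair with a given pattern -/

section Construction

variable {n m : ℕ}

/-- The backward orbit of the state under the predecessor map `σ` ends at an input. -/
inductive IsStem (σ : Fin n → Fin n ⊕ Fin m) : Fin n → Prop
  | base {i a} : σ i = Sum.inr a → IsStem σ i
  | step {i j} : σ i = Sum.inl j → IsStem σ j → IsStem σ i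

/-- The set `R` of states contains all successors of inputs under the predecessor map `σ`, and
contains a state if and only if it contains its predecessor. Such a set consists of all the stems
and of some whole cycles. -/
structure IsSaturated (σ : Fin n → Fin n ⊕ Fin m) (R : Finset (Fin n)) : Prop where
  input : ∀ i a, σ i = Sum.inr a → i ∈ R
  state : ∀ i j, σ i = Sum.inl j → (i ∈ R ↔ j ∈ R)

variable {σ : Fin n → Fin n ⊕ Fin m} {E : Fin n → Fin n ⊕ Fin m → Prop}

/-- The stems, with weight `1` on each edge from `σ i` to `i`, pass the eigenvector test: along a
stem, each coordinate of an eigenvector is a multiple of the preceding one, and the first one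
vanishes. -/
theorem exists_hautusOn_stems (hσ : Function.Injective σ) (hE : ∀ i, E i (σ i)) :
    ∃ R, IsSaturated σ R ∧ ∃ M, HautusOn R M ∧ ∀ i v, M i v ≠ 0 → E i v := by
  classical
  let M : Matrix (Fin n) (Fin n ⊕ Fin m) ℝ :=
    Matrix.of fun i v => if IsStem σ i ∧ σ i = v then 1 else 0
  have hM : ∀ {i v}, M i v ≠ 0 → IsStem σ i ∧ σ i = v := fun {i v} h => by
    by_contra hc
    exact h (if_neg hc)
  have hiff : ∀ i j, σ i = Sum.inl j → (IsStem σ i ↔ IsStem σ j) := fun i j hij => by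
    refine ⟨fun h => ?_, .step hij⟩
    cases h with
    | base h => simp [hij] at h
    | step h h' => rwa [Sum.inl_injective (hij.symm.trans h)]
  refine ⟨Finset.univ.filter (IsStem σ), ⟨fun i a h => ?_, fun i j h => ?_⟩, M,
    ⟨fun i v h => ?_, fun i j h => ?_, ?_⟩, fun i v h => ?_⟩
  · simpa using IsStem.base h
  · simpa using hiff i j h
  · simpa using (hM h).1
  · simpa using (hiff _ _ (hM h).2).1 (hM h).1
  · intro μ z h1 h2 i hi
    have hi : IsStem σ i := by simpa using hi
    -- the only entry in the column of `σ i` is in row `i`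
    have hcol : ∀ i, IsStem σ i → ∑ k, z k * (M k (σ i) : ℂ) = z i := fun i hi => by
      rw [Finset.sum_eq_single i]
      · simp [M, hi]
      · intro k _ hk
        simp [M, hσ.ne hk]
      · simp
    induction hi with
    | @base i a h =>
      rw [← hcol i (.base h), h, ← inputAction_apply, h2, Pi.zero_apply]
    | @step i j h hj ih =>
      rw [← hcol i (.step h hj), h, ← stateAction_apply, h1 j (by simpa using hj),
        ih (by simpa using hj), mul_zero]
  · rw [← (hM h).2]
    exact hE i

/-- Inductive step: a cycle of `σ` outside `R` that contains the end `i₀` of an edge from an input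
or from `R` can be added to `R`. The edges of the cycle get a large weight `t`, the edge from `v₀`
to `i₀` gets weight `1`. An eigenvector that vanishes on the cycle restricts to one on `R`.
Otherwise its eigenvalue has absolute value `t`, which `exists_bound_resonance` excludes. -/
theorem HautusOn.exists_larger (hσ : Function.Injective σ) (hE : ∀ i, E i (σ i))
    {R : Finset (Fin n)} (hR : IsSaturated σ R) {M : Matrix (Fin n) (Fin n ⊕ Fin m) ℝ}
    (hM : HautusOn R M) (hME : ∀ i v, M i v ≠ 0 → E i v)
    {i₀ : Fin n} (hi₀ : i₀ ∉ R) {v₀ : Fin n ⊕ Fin m} (hE₀ : E i₀ v₀)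
    (hv₀ : ∀ j, v₀ = Sum.inl j → j ∈ R) :
    ∃ R', R ⊂ R' ∧ IsSaturated σ R' ∧ ∃ M', HautusOn R' M' ∧ ∀ i v, M' i v ≠ 0 → E i v := by
  classical
  have hpred : ∀ i : {i // i ∉ R}, ∃ j : {i // i ∉ R}, σ i = Sum.inl j.1 := by
    rintro ⟨i, hi⟩
    rcases h : σ i with j | a
    · exact ⟨⟨j, mt (hR.state i j h).2 hi⟩, rfl⟩
    · exact absurd (hR.input i a h) hi
  -- outside of `R`, the predecessor map is a permutation `π`, and `C` is the cycle of `i₀`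
  choose ρ hρ using hpred
  have hρinj : Function.Injective ρ := fun i j hij =>
    Subtype.ext (hσ (by rw [hρ, hρ, hij]))
  let π : Equiv.Perm {i // i ∉ R} := Equiv.ofBijective ρ (Finite.injective_iff_bijective.1 hρinj)
  have hπ : ∀ i, σ i.1 = Sum.inl (π i).1 := hρ
  let C : Finset (Fin n) := Finset.univ.filter fun i => ∃ h : i ∉ R, π.SameCycle ⟨i₀, hi₀⟩ ⟨i, h⟩
  have hC : ∀ {i}, i ∈ C ↔ ∃ h : i ∉ R, π.SameCycle ⟨i₀, hi₀⟩ ⟨i, h⟩ := by simp [C]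
  have hi₀C : i₀ ∈ C := hC.2 ⟨hi₀, .refl _ _⟩
  have hCstate : ∀ i j, σ i = Sum.inl j → (i ∈ C ↔ j ∈ C) := fun i j hij => by
    by_cases hi : i ∈ R
    · have hj := (hR.state i j hij).1 hi
      simp [hC, hi, hj]
    · have hj : j = (π ⟨i, hi⟩).1 := Sum.inl_injective (hij.symm.trans (hπ ⟨i, hi⟩))
      subst hj
      simp [hC, hi, (π ⟨i, hi⟩).2]
  -- the row of the edge from `v₀`, with its state part `e` and its input part `f`
  let e : Fin n → ℂ := fun j => if Sum.inl j = v₀ then 1 else 0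
  let f : Fin m → ℂ := fun a => if Sum.inr a = v₀ then 1 else 0
  obtain ⟨T, hT⟩ := exists_bound_resonance (stateAction M) (inputAction M) e f <| by
    rcases v₀ with j | a
    · right
      by_contra hk
      push Not at hk
      have h0 := hM.eq_zero_of_forall_pow (z := e) (fun i hi => if_neg fun h => hi ?_) hk
      · simpa [e] using congrFun h0 j
      · rw [Sum.inl_injective h]
        exact hv₀ j rfl
    · left
      intro h0
      simpa [f] using congrFun h0 a
  -- at least `T` to exclude resonance, and positive
  let t : ℝ := max T 1
  have ht : (t : ℂ) ≠ 0 := by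
    have : 0 < t := lt_of_lt_of_le one_pos (le_max_right _ _)
    exact_mod_cast this.ne'
  let M' : Matrix (Fin n) (Fin n ⊕ Fin m) ℝ := Matrix.of fun i v =>
    M i v + (if i ∈ C ∧ σ i = v then t else 0) + (if i = i₀ ∧ v = v₀ then 1 else 0)
  have hM' : ∀ {i v}, M' i v ≠ 0 → M i v ≠ 0 ∨ (i ∈ C ∧ σ i = v) ∨ (i = i₀ ∧ v = v₀) :=
    fun {i v} h => by
      by_contra! hc
      refine h ?_
      simp only [M', Matrix.of_apply]
      rw [hc.1, if_neg (fun h => hc.2.1 h.1 h.2), if_neg (fun h => hc.2.2 h.1 h.2)]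
      simp
  -- the columns of `M'` that belong to the new cycle
  have hcolC : ∀ (z : Fin n → ℂ) (i : Fin n) (hi : i ∈ C) (j : Fin n), σ i = Sum.inl j →
      stateAction M' z j = z i * t := fun z i hi j hij => by
    have hjR : j ∉ R := (hC.1 ((hCstate i j hij).1 hi)).1
    rw [stateAction_apply, Finset.sum_eq_single i]
    · have h1 : M i (Sum.inl j) = 0 := not_not.1 (mt (hM.col_mem i j) hjR)
      have h2 : ¬ (i = i₀ ∧ Sum.inl j = v₀) := fun h => hjR (hv₀ j h.2.symm)
      simp [M', h1, h2, hi, hij]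
    · intro k _ hk
      have h1 : M' k (Sum.inl j) = 0 := by
        by_contra hne
        rcases hM' hne with h | h | h
        · exact hjR (hM.col_mem k j h)
        · exact hk (hσ (h.2.trans hij.symm))
        · exact hjR (hv₀ j h.2.symm)
      simp [h1]
    · simp
  -- the columns of `M'` that belong to old states and to inputs
  have hcolR : ∀ (z : Fin n → ℂ) (v : Fin n ⊕ Fin m), (∀ j, v = Sum.inl j → j ∈ R) →
      ∑ i, z i * (M' i v : ℂ) = ∑ i, z i * (M i v : ℂ) + z i₀ * (if v = v₀ then 1 else 0) := by
    intro z v hv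
    have h1 : ∀ i, ¬ (i ∈ C ∧ σ i = v) := fun i ⟨hi, hiv⟩ => by
      obtain ⟨hiR, -⟩ := hC.1 hi
      exact (π ⟨i, hiR⟩).2 (hv _ (hiv.symm.trans (hπ ⟨i, hiR⟩)))
    simp only [M', Matrix.of_apply, if_neg (h1 _), add_zero, Complex.ofReal_add, mul_add,
      Finset.sum_add_distrib]
    congr 1
    rw [Finset.sum_eq_single i₀]
    · by_cases h : v = v₀ <;> simp [h]
    · intro k _ hk
      simp [hk]
    · simp
  refine ⟨R ∪ C, ?_, ⟨fun i a h => ?_, fun i j h => ?_⟩, M', ⟨?_, ?_, ?_⟩, ?_⟩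
  · exact Finset.ssubset_iff_subset_ne.2 ⟨Finset.subset_union_left, fun h => hi₀ (by
      rw [h]; exact Finset.mem_union_right _ hi₀C)⟩
  · exact Finset.mem_union_left _ (hR.input i a h)
  · rw [Finset.mem_union, Finset.mem_union, hR.state i j h, hCstate i j h]
  · intro i v h
    rw [Finset.mem_union]
    rcases hM' h with h | h | h
    exacts [.inl (hM.row_mem i v h), .inr h.1, .inr (h.1 ▸ hi₀C)]
  · intro i j h
    rw [Finset.mem_union]
    rcases hM' h with h | h | h
    exacts [.inl (hM.col_mem i j h), .inr ((hCstate i j h.2).1 h.1), .inl (hv₀ j h.2.symm)]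
  · intro μ z h1 h2
    have hcyc : ∀ k (i : {i // i ∉ R}), i.1 ∈ C → z i.1 * t ^ k = μ ^ k * z ((π ^ k) i).1 := by
      intro k
      induction k with
      | zero => simp
      | succ k ih =>
        intro i hi
        have hi' : (π i).1 ∈ C := (hCstate _ _ (hπ i)).1 hi
        have hstep : z i.1 * t = μ * z (π i).1 := by
          rw [← hcolC z i.1 hi _ (hπ i)]
          exact h1 _ (Finset.mem_union_right _ hi')
        calc z i.1 * t ^ (k + 1) = z i.1 * t * t ^ k := by ring
          _ = μ * (z (π i).1 * t ^ k) := by rw [hstep]; ring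
          _ = μ ^ (k + 1) * z ((π ^ (k + 1)) i).1 := by
            rw [ih _ hi', pow_succ π, Equiv.Perm.mul_apply]; ring
    by_cases hz0 : z i₀ = 0
    · have hzC : ∀ i ∈ C, z i = 0 := fun i hi => by
        obtain ⟨hiR, hs⟩ := hC.1 hi
        obtain ⟨k, hk⟩ := hs.symm.exists_nat_pow_eq
        have := hcyc k ⟨i, hiR⟩ hi
        rw [hk, hz0, mul_zero] at this
        exact (mul_eq_zero.1 this).resolve_right (pow_ne_zero _ ht)
      have hzR := hM.eq_zero μ z (fun j hj => ?_) (funext fun a => ?_)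
      · intro i hi
        exact (Finset.mem_union.1 hi).elim (hzR i) (hzC i)
      · rw [← h1 j (Finset.mem_union_left _ hj), stateAction_apply, stateAction_apply,
          hcolR z _ (by rintro _ ⟨⟩; exact hj), hz0, zero_mul, add_zero]
      · have := congrFun h2 a
        rwa [inputAction_apply, hcolR z _ (by simp), hz0, zero_mul, add_zero] at this
    · exfalso
      -- going once around the cycle shows that `μ` has absolute value `t`
      have hμ : ‖μ‖ = t := by
        have h := hcyc (orderOf π) ⟨i₀, hi₀⟩ hi₀C
        rw [pow_orderOf_eq_one, mul_comm] at h
        have h' := congrArg norm (mul_right_cancel₀ hz0 h)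
        rw [norm_pow, norm_pow] at h'
        have h3 := (pow_left_inj₀ (norm_nonneg _) (norm_nonneg _) (orderOf_pos π).ne').1 h'
        rw [← h3, Complex.norm_real, Real.norm_eq_abs,
          abs_of_pos (lt_of_lt_of_le one_pos (le_max_right _ _))]
      -- the eigenvector on `R`, scaled so that its coordinate at `i₀` is `1`
      let y : Fin n → ℂ := fun i => if i ∈ R then (z i₀)⁻¹ * z i else 0
      have hy : ∀ v, ∑ i, y i * (M i v : ℂ) = (z i₀)⁻¹ * ∑ i, z i * (M i v : ℂ) := fun v => by
        rw [Finset.mul_sum]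
        refine Finset.sum_congr rfl fun i _ => ?_
        by_cases hi : i ∈ R
        · simp [y, hi, mul_assoc]
        · rw [not_not.1 (mt (hM.row_mem i v) hi)]
          simp
      refine absurd (hT y μ (funext fun j => ?_) (funext fun a => ?_))
        (by rw [hμ]; exact not_lt.2 (le_max_left _ _))
      · rw [Pi.add_apply, stateAction_apply, hy, Pi.smul_apply, smul_eq_mul]
        by_cases hj : j ∈ R
        · have := h1 j (Finset.mem_union_left _ hj)
          rw [stateAction_apply, hcolR z _ (by rintro _ ⟨⟩; exact hj)] at this
          rw [eq_sub_of_add_eq this]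
          simp only [y, e, hj, if_true]
          field_simp
          ring
        · have h0 : ∀ i, M i (Sum.inl j) = 0 := fun i => not_not.1 (mt (hM.col_mem i j) hj)
          have hne : Sum.inl j ≠ v₀ := fun h => hj (hv₀ j h.symm)
          simp [h0, y, hj, e, hne]
      · have := congrFun h2 a
        rw [inputAction_apply, hcolR z _ (by simp), Pi.zero_apply] at this
        rw [Pi.add_apply, inputAction_apply, hy, eq_neg_of_add_eq_zero_left this]
        simp only [f, Pi.zero_apply]
        field_simp
        ring
  · intro i v h
    rcases hM' h with h | h | h
    exacts [hME i v h, h.2 ▸ hE i, h.1 ▸ h.2 ▸ hE₀]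

/-- A pattern `E` of free entries admits a controllable pair if it has an injective choice `σ` of
predecessors, and if each proper subset of the states is left by some edge that starts in it or at
an input. -/
theorem exists_controllable_of_pattern (hσ : Function.Injective σ) (hE : ∀ i, E i (σ i))
    (hcross : ∀ R : Finset (Fin n), R ≠ Finset.univ →
      ∃ i ∉ R, ∃ v, E i v ∧ ∀ j, v = Sum.inl j → j ∈ R) :
    ∃ M : Matrix (Fin n) (Fin n ⊕ Fin m) ℝ, (∀ i v, M i v ≠ 0 → E i v) ∧
      Controllable M.toCols₁ M.toCols₂ := by
  obtain ⟨R, hmax⟩ := (Set.toFinite {R : Finset (Fin n) | IsSaturated σ R ∧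
    ∃ M, HautusOn R M ∧ ∀ i v, M i v ≠ 0 → E i v}).exists_maximal (exists_hautusOn_stems hσ hE)
  obtain ⟨hR, M, hM, hME⟩ := hmax.prop
  by_cases htop : R = Finset.univ
  · subst htop
    exact ⟨M, hME, hM.controllable⟩
  · obtain ⟨i, hi, v, hv, hvR⟩ := hcross R htop
    obtain ⟨R', hlt, hR'⟩ := hM.exists_larger hσ hE hR hME hi hv hvR
    exact absurd hlt (hmax.not_gt hR')

end Construction

/-! ### The conditions on the input side -/

section Necessity

open SysVertex

namespace StructuredSystem

variable {nu nx ny : ℕ} {S : StructuredSystem nu nx ny}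

theorem structuredMatrix_ne_zero {m n : ℕ} {T : Set (Fin m × Fin n)} {v : ↥(Tᶜ) → ℝ} {i : Fin m}
    {j : Fin n} (h : structuredMatrix T v i j ≠ 0) : (i, j) ∉ T :=
  fun hT => h (by simp [structuredMatrix, hT])

/-- The states that are not reachable from the inputs stay at zero, whatever the input. -/
theorem reachable_of_controllable {A : Matrix (Fin nx) (Fin nx) ℝ} {B : Matrix (Fin nx) (Fin nu) ℝ}
    (hA : ∀ i j, A i j ≠ 0 → (i, j) ∉ S.TA) (hB : ∀ i a, B i a ≠ 0 → (i, a) ∉ S.TB)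
    (hc : Controllable A B) (i : Fin nx) :
    ∃ a, Relation.ReflTransGen S.graph.Adj (u a) (x i) := by
  by_contra hi
  have hrow : ∀ (k : ℕ) (i : Fin nx), (¬ ∃ a, Relation.ReflTransGen S.graph.Adj (u a) (x i)) →
      ∀ a : Fin nu, (A ^ k * B : Matrix (Fin nx) (Fin nu) ℝ) i a = 0 := by
    intro k
    induction k with
    | zero =>
      intro i hi a
      rw [pow_zero, Matrix.one_mul]
      by_contra h
      exact hi ⟨a, .single (graph_adj_x (v := Sum.inr a).2 (hB i a h))⟩
    | succ k ih =>
      intro i hi a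
      rw [pow_succ', Matrix.mul_assoc, Matrix.mul_apply]
      refine Finset.sum_eq_zero fun j _ => ?_
      by_cases hj : ∃ a, Relation.ReflTransGen S.graph.Adj (u a) (x j)
      · obtain ⟨b, hb⟩ := hj
        have : A i j = 0 := by
          by_contra h
          exact hi ⟨b, hb.tail (graph_adj_x (v := Sum.inl j).2 (hA i j h))⟩
        rw [this, zero_mul]
      · rw [ih j hj, mul_zero]
  have h0 := hc (Pi.single i 1) fun k => funext fun a => by
    simpa using hrow k i hi a
  simpa using congrFun h0 i

/-- For a controllable pair the matrix `[A B]` has full row rank, so one of the terms in the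
expansion of a nonzero maximal minor is nonzero; it selects a predecessor for each state. -/
theorem exists_injective_of_controllable {A : Matrix (Fin nx) (Fin nx) ℝ}
    {B : Matrix (Fin nx) (Fin nu) ℝ}
    (hA : ∀ i j, A i j ≠ 0 → (i, j) ∉ S.TA) (hB : ∀ i a, B i a ≠ 0 → (i, a) ∉ S.TB)
    (hc : Controllable A B) :
    ∃ σ : Fin nx → Fin nx ⊕ Fin nu, Function.Injective σ ∧ ∀ i, S.FreeInto i (σ i) := by
  obtain ⟨g, hg⟩ := exists_selection_det_ne_zero (fun v i => Matrix.fromCols A B i v) fun z hz => by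
    have hzA : z ᵥ* A = 0 := funext fun j => hz (Sum.inl j)
    have hzB : z ᵥ* B = 0 := funext fun a => hz (Sum.inr a)
    refine hc z fun k => ?_
    cases k with
    | zero => simpa using hzB
    | succ k => rw [pow_succ', Matrix.mul_assoc, ← Matrix.vecMul_vecMul, hzA, Matrix.zero_vecMul]
  have hginj : Function.Injective g := fun r s hrs => by
    by_contra hne
    exact hg (Matrix.det_zero_of_column_eq hne fun i => by simp [hrs])
  rw [Matrix.det_apply] at hg
  obtain ⟨π, -, hπ⟩ := Finset.exists_ne_zero_of_sum_ne_zero hg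
  have hprod := right_ne_zero_of_smul hπ
  rw [Finset.prod_ne_zero_iff] at hprod
  refine ⟨g ∘ π.symm, hginj.comp π.symm.injective, fun i => ?_⟩
  have h := hprod (π.symm i) (Finset.mem_univ _)
  simp only [Matrix.of_apply, Equiv.apply_symm_apply] at h
  rw [Function.comp_apply]
  rcases hv : g (π.symm i) with j | a <;> rw [hv] at h
  exacts [hA i j h, hB i a h]

theorem exists_crossing_of_reachable
    (h : ∀ i : Fin nx, ∃ a, Relation.ReflTransGen S.graph.Adj (u a) (x i))
    (R : Finset (Fin nx)) (hR : R ≠ Finset.univ) :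
    ∃ i ∉ R, ∃ v, S.FreeInto i v ∧ ∀ j, v = Sum.inl j → j ∈ R := by
  by_contra! hno
  have hinv : ∀ a w, Relation.ReflTransGen S.graph.Adj (u a) w → ∀ i, w = x i → i ∈ R := by
    intro a w hw
    induction hw with
    | refl => rintro i h; simp [u, x] at h
    | tail _ hbc ih =>
      rintro i rfl
      by_contra hi
      obtain ⟨v, rfl, hv⟩ := exists_freeInto_of_adj_x hbc
      obtain ⟨j, rfl, hj⟩ := hno i hi v hv
      exact hj (ih j rfl)
  refine hR (Finset.eq_univ_iff_forall.2 fun i => ?_)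
  obtain ⟨a, ha⟩ := h i
  exact hinv a _ ha i rfl

/-- Every state is reached by a path from an input, and the states are covered by disjoint paths
that start at inputs and cycles. -/
def InputConditions (S : StructuredSystem nu nx ny) : Prop :=
  (∀ i : Fin nx, ∃ l, S.graph.IsPathList l ∧ URooted l ∧ l.getLast? = some (x i)) ∧
  ∃ F₁ F₂ : Set (List (SysVertex nu nx ny)),
    S.graph.IsPathFamily F₁ ∧ (∀ l ∈ F₁, URooted l) ∧
    S.graph.IsCycleFamily F₂ ∧ FamiliesDisjoint F₁ F₂ ∧
    ∀ i : Fin nx, FamilyCovers (F₁ ∪ F₂) (x i)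

theorem inputConditions_of_controllable {A : Matrix (Fin nx) (Fin nx) ℝ}
    {B : Matrix (Fin nx) (Fin nu) ℝ}
    (hA : ∀ i j, A i j ≠ 0 → (i, j) ∉ S.TA) (hB : ∀ i a, B i a ≠ 0 → (i, a) ∉ S.TB)
    (hc : Controllable A B) : S.InputConditions := by
  obtain ⟨σ, hσ, hfree⟩ := exists_injective_of_controllable hA hB hc
  exact ⟨fun i => exists_uRooted_iff.2 (reachable_of_controllable hA hB hc i),
    exists_families_of_injective hσ hfree⟩

theorem InputConditions.exists_controllable (h : S.InputConditions) :
    ∃ M : Matrix (Fin nx) (Fin nx ⊕ Fin nu) ℝ, (∀ i v, M i v ≠ 0 → S.FreeInto i v) ∧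
      Controllable M.toCols₁ M.toCols₂ := by
  obtain ⟨h1, F₁, F₂, hF₁, hU, hF₂, hd, hcov⟩ := h
  obtain ⟨σ, hσ, hfree⟩ := exists_injective_of_families hF₁ hU hF₂ hd hcov
  exact exists_controllable_of_pattern hσ hfree
    (exists_crossing_of_reachable fun i => exists_uRooted_iff.1 (h1 i))

end StructuredSystem

end Necessity

/-! ### Duality -/

section Duality

open SysVertex

variable {nu nx ny : ℕ}

/-- The bijection of vertices that exchanges inputs and outputs. -/
def SysVertex.dual : SysVertex nu nx ny → SysVertex ny nx nu
  | Sum.inl (Sum.inl i) => x i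
  | Sum.inl (Sum.inr a) => y a
  | Sum.inr j => u j

theorem SysVertex.dual_dual (v : SysVertex nu nx ny) : v.dual.dual = v := by
  rcases v with (_ | _) | _ <;> rfl

theorem SysVertex.dual_injective :
    Function.Injective (dual : SysVertex nu nx ny → SysVertex ny nx nu) :=
  Function.LeftInverse.injective dual_dual

/-- The reversed list, with inputs and outputs exchanged. -/
def dualList (l : List (SysVertex nu nx ny)) : List (SysVertex ny nx nu) :=
  (l.map dual).reverse

theorem URooted.yTopped_dualList {l : List (SysVertex nu nx ny)} (h : URooted l) :
    YTopped (dualList l) := by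
  obtain ⟨a, ha⟩ := h
  exact ⟨a, by simp [dualList, ha]; rfl⟩

theorem YTopped.uRooted_dualList {l : List (SysVertex nu nx ny)} (h : YTopped l) :
    URooted (dualList l) := by
  obtain ⟨j, hj⟩ := h
  exact ⟨j, by simp [dualList, hj]; rfl⟩

theorem FamiliesDisjoint.image_dualList {F₁ F₂ : Set (List (SysVertex nu nx ny))}
    (h : FamiliesDisjoint F₁ F₂) : FamiliesDisjoint (dualList '' F₁) (dualList '' F₂) := by
  rintro _ ⟨l, hl, rfl⟩ _ ⟨l', hl', rfl⟩
  exact disjoint_map_reverse dual_injective (h l hl l' hl')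

theorem FamilyCovers.image_dualList {F₁ F₂ : Set (List (SysVertex nu nx ny))} {i : Fin nx}
    (h : FamilyCovers (F₁ ∪ F₂) (x i)) :
    FamilyCovers (dualList '' F₁ ∪ dualList '' F₂) (x i) := by
  obtain ⟨l, hl, hi⟩ := h
  rw [← Set.image_union]
  exact ⟨_, ⟨l, hl, rfl⟩, List.mem_reverse.2 (List.mem_map.2 ⟨_, hi, rfl⟩)⟩

namespace StructuredSystem

/-- The dual structured system, with all four patterns transposed and inputs and outputs
exchanged. -/
def transpose (S : StructuredSystem nu nx ny) : StructuredSystem ny nx nu :=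
  ⟨Prod.swap ⁻¹' S.TA, Prod.swap ⁻¹' S.TC, Prod.swap ⁻¹' S.TB, Prod.swap ⁻¹' S.TD⟩

theorem graph_transpose_adj {S : StructuredSystem nu nx ny} (v w : SysVertex nu nx ny)
    (h : S.graph.Adj v w) : S.transpose.graph.Adj w.dual v.dual := by
  rcases w with (i | a) | j
  · obtain ⟨j | a, rfl, hv⟩ := exists_freeInto_of_adj_x h
    · exact graph_adj_x (v := Sum.inl i).2 hv
    · exact graph_adj_x_y.2 hv
  · exact absurd h (not_graph_adj_u v a)
  · rcases v with (i | a) | j'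
    · exact graph_adj_x (v := Sum.inr j).2 (graph_adj_x_y.1 h)
    · exact graph_adj_u_y.2 (graph_adj_u_y.1 h)
    · exact absurd h (not_graph_adj_of_y j' _)

/-- The input conditions for the dual system are the output conditions for the system itself, by
reversal of all paths and cycles. -/
theorem inputConditions_transpose {S : StructuredSystem nu nx ny} :
    S.transpose.InputConditions ↔
      (∀ i : Fin nx, ∃ l, S.graph.IsPathList l ∧ YTopped l ∧ l.head? = some (x i)) ∧
      ∃ F₁ F₂ : Set (List (SysVertex nu nx ny)),
        S.graph.IsPathFamily F₁ ∧ (∀ l ∈ F₁, YTopped l) ∧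
        S.graph.IsCycleFamily F₂ ∧ FamiliesDisjoint F₁ F₂ ∧
        ∀ i : Fin nx, FamilyCovers (F₁ ∪ F₂) (x i) := by
  constructor
  · rintro ⟨h1, F₁, F₂, hF₁, hU, hF₂, hd, hcov⟩
    refine ⟨fun i => ?_, dualList '' F₁, dualList '' F₂,
      hF₁.image_map_reverse dual_injective graph_transpose_adj, ?_,
      hF₂.image_map_reverse dual_injective graph_transpose_adj, hd.image_dualList,
      fun i => (hcov i).image_dualList⟩
    · obtain ⟨l, hl, hr, hi⟩ := h1 i
      exact ⟨dualList l, hl.map_reverse dual_injective graph_transpose_adj, hr.yTopped_dualList,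
        by simp [dualList, hi]; rfl⟩
    · rintro _ ⟨l, hl, rfl⟩
      exact (hU l hl).yTopped_dualList
  · rintro ⟨h1, F₁, F₂, hF₁, hU, hF₂, hd, hcov⟩
    refine ⟨fun i => ?_, dualList '' F₁, dualList '' F₂,
      hF₁.image_map_reverse dual_injective graph_transpose_adj, ?_,
      hF₂.image_map_reverse dual_injective graph_transpose_adj, hd.image_dualList,
      fun i => (hcov i).image_dualList⟩
    · obtain ⟨l, hl, hr, hi⟩ := h1 i
      exact ⟨dualList l, hl.map_reverse dual_injective graph_transpose_adj, hr.uRooted_dualList,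
        by simp [dualList, hi]; rfl⟩
    · rintro _ ⟨l, hl, rfl⟩
      exact (hU l hl).uRooted_dualList

end StructuredSystem

end Duality

/-! ### Generic minimality -/

section Generic

namespace StructuredSystem

variable {nu nx ny : ℕ}

/-- The structured matrix with fixed zeros `T` whose free entries are indeterminates; the
indeterminate at the position `t` is the one with index `e t`. -/
noncomputable def genericMatrix {ι : Type*} {m n : ℕ} (T : Set (Fin m × Fin n))
    (e : ↥(Tᶜ) → ι) : Matrix (Fin m) (Fin n) (MvPolynomial ι ℝ) :=
  open Classical in
  Matrix.of fun i j => if h : (i, j) ∈ T then 0 else MvPolynomial.X (e ⟨(i, j), h⟩)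

theorem genericMatrix_map_eval {ι : Type*} {m n : ℕ} (T : Set (Fin m × Fin n)) (e : ↥(Tᶜ) → ι)
    (p : ι → ℝ) :
    (genericMatrix T e).map (MvPolynomial.eval p) = structuredMatrix T fun t => p (e t) := by
  ext i j
  by_cases h : (i, j) ∈ T <;> simp [genericMatrix, structuredMatrix, h]

theorem structuredMatrix_eq {m n : ℕ} {T : Set (Fin m × Fin n)} {N : Matrix (Fin m) (Fin n) ℝ}
    (h : ∀ i j, N i j ≠ 0 → (i, j) ∉ T) :
    structuredMatrix T (fun t => N t.1.1 t.1.2) = N := by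
  ext i j
  by_cases hT : (i, j) ∈ T
  · simpa [structuredMatrix, hT, eq_comm] using fun hne => h i j hne hT
  · simp [structuredMatrix, hT]

theorem exists_polynomial_controllable {S : StructuredSystem nu nx ny} (h : S.InputConditions) :
    ∃ f : MvPolynomial S.Param ℝ, f ≠ 0 ∧ ∀ p, MvPolynomial.eval p f ≠ 0 →
      Controllable (S.sys p).A (S.sys p).B := by
  obtain ⟨M, hM, hc⟩ := h.exists_controllable
  let p₀ : S.Param → ℝ := Sum.elim (Sum.elim (fun t => M.toCols₁ t.1.1 t.1.2)
    (fun t => M.toCols₂ t.1.1 t.1.2)) fun _ => 0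
  obtain ⟨f, hf, hfp⟩ := Controllable.exists_polynomial
    (genericMatrix S.TA fun t => (Sum.inl (Sum.inl t) : S.Param))
    (genericMatrix S.TB fun t => (Sum.inl (Sum.inr t) : S.Param)) (p₀ := p₀) (by
      rw [genericMatrix_map_eval, genericMatrix_map_eval]
      convert hc using 1
      · exact structuredMatrix_eq fun i j => hM i (Sum.inl j)
      · exact structuredMatrix_eq fun i a => hM i (Sum.inr a))
  refine ⟨f, fun h0 => hf (by rw [h0, map_zero]), fun p hp => ?_⟩
  have := hfp p hp
  rwa [genericMatrix_map_eval, genericMatrix_map_eval] at this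

/-- The identification of the parameters of the dual structured system. -/
def paramTranspose (S : StructuredSystem nu nx ny) : S.transpose.Param → S.Param
  | Sum.inl (Sum.inl t) => Sum.inl (Sum.inl ⟨t.1.swap, t.2⟩)
  | Sum.inl (Sum.inr t) => Sum.inr (Sum.inl ⟨t.1.swap, t.2⟩)
  | Sum.inr (Sum.inl t) => Sum.inl (Sum.inr ⟨t.1.swap, t.2⟩)
  | Sum.inr (Sum.inr t) => Sum.inr (Sum.inr ⟨t.1.swap, t.2⟩)

theorem paramTranspose_injective (S : StructuredSystem nu nx ny) :
    Function.Injective S.paramTranspose :=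
  Function.LeftInverse.injective (g := S.transpose.paramTranspose) fun t => by
    rcases t with (_ | _) | (_ | _) <;> rfl

theorem sys_transpose (S : StructuredSystem nu nx ny) (p : S.Param → ℝ) :
    S.transpose.sys (p ∘ S.paramTranspose) = (S.sys p).transpose := rfl

theorem inputConditions_of_isMinimal {S : StructuredSystem nu nx ny} {p : S.Param → ℝ}
    (h : (S.sys p).IsMinimal) : S.InputConditions :=
  inputConditions_of_controllable (A := (S.sys p).A) (B := (S.sys p).B)
    (fun _ _ h => structuredMatrix_ne_zero (v := fun t => p (Sum.inl (Sum.inl t))) h)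
    (fun _ _ h => structuredMatrix_ne_zero (v := fun t => p (Sum.inl (Sum.inr t))) h) h.controllable

theorem isGeneric_isMinimal_iff {S : StructuredSystem nu nx ny} :
    S.IsGeneric LTISystem.IsMinimal ↔ S.InputConditions ∧ S.transpose.InputConditions := by
  constructor
  · -- one parameter vector with a minimal system suffices
    rintro ⟨f, hne, hf⟩
    obtain ⟨p, hp⟩ := (Set.ne_univ_iff_exists_notMem _).1 hne
    have hmin := hf p hp
    refine ⟨inputConditions_of_isMinimal hmin, ?_⟩
    have hmin' := hmin.transpose
    rw [← sys_transpose] at hmin'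
    exact inputConditions_of_isMinimal hmin'
  · rintro ⟨h, h'⟩
    obtain ⟨f, hf, hfp⟩ := exists_polynomial_controllable h
    obtain ⟨f', hf', hfp'⟩ := exists_polynomial_controllable h'
    refine ⟨f * MvPolynomial.rename S.paramTranspose f', fun hall => ?_, fun p hp => ?_⟩
    · refine mul_ne_zero hf ((map_ne_zero_iff _
        (MvPolynomial.rename_injective _ S.paramTranspose_injective)).2 hf') ?_
      refine MvPolynomial.funext fun p => ?_
      rw [map_zero]
      exact Set.eq_univ_iff_forall.1 hall p
    · rw [Set.mem_ofPred_eq, map_mul, MvPolynomial.eval_rename] at hp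
      have ho := hfp' _ (right_ne_zero_of_mul hp)
      rw [sys_transpose] at ho
      exact LTISystem.isMinimal_of_controllable (hfp p (left_ne_zero_of_mul hp)) ho

end StructuredSystem

end Generic

theorem mainTheorem1 {nu nx ny : ℕ} (S : StructuredSystem nu nx ny) :
    S.IsGeneric LTISystem.IsMinimal ↔
      (∀ i : Fin nx, ∃ l, S.graph.IsPathList l ∧ URooted l ∧
        l.getLast? = some (SysVertex.x i)) ∧
      (∃ F₁ F₂ : Set (List (SysVertex nu nx ny)),
        S.graph.IsPathFamily F₁ ∧ (∀ l ∈ F₁, URooted l) ∧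
        S.graph.IsCycleFamily F₂ ∧ FamiliesDisjoint F₁ F₂ ∧
        ∀ i : Fin nx, FamilyCovers (F₁ ∪ F₂) (SysVertex.x i)) ∧
      (∀ i : Fin nx, ∃ l, S.graph.IsPathList l ∧ YTopped l ∧
        l.head? = some (SysVertex.x i)) ∧
      (∃ F₁ F₂ : Set (List (SysVertex nu nx ny)),
        S.graph.IsPathFamily F₁ ∧ (∀ l ∈ F₁, YTopped l) ∧
        S.graph.IsCycleFamily F₂ ∧ FamiliesDisjoint F₁ F₂ ∧
        ∀ i : Fin nx, FamilyCovers (F₁ ∪ F₂) (SysVertex.x i)) := by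
  rw [StructuredSystem.isGeneric_isMinimal_iff, StructuredSystem.inputConditions_transpose,
    StructuredSystem.InputConditions, and_assoc]
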